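/- Let $G_{ph}=(V,E_{ph})$ be a finite simple graph (the physical graph) and $R>0$. For $x\in\mathbb R^V$, the influence graph $\tilde G(x)$ on $V$ has as edges those $\{i,j\}\in E_{ph}$ with $|x_i-x_j|\le R$. The social Hegselmann–Krause dynamics started at $x[0]\in\mathbb R^V$ is $x_i[k+1]=\frac1{|\mathcal N_i[k]|}\sum_{j\in\mathcal N_i[k]}x_j[k]$, where $\mathcal N_i[k]$ consists of $i$ and its neighbours in $\tilde G[k]:=\tilde G(x[k])$. For a finite simple graph $H$, the normalized adjacency matrix $A_H$ has $(A_H)_{ij}=1/(1+\deg_H i)$ if $j=i$ or $j$ is adjacent to $i$ in $H$, and $(A_H)_{ij}=0$ otherwise. Let $V_P,V_Q\subseteq V$ be disjoint, let $G_{P}[k]$ be the subgraph of $\tilde G[k]$ induced by $V_P$, and let $G_{P_0}$ be the subgraph of $G_{ph}$ induced by $V_P$; assume that $G_{P_0}$ is connected. Let $A_{P_0}$ be its normalized adjacency matrix, and let $[l]\subseteq V_P$ denote the set of nodes of $V_P$ that are adjacent in $G_{ph}$ to at least one node of $V_Q$. We say that $V_P$ and $V_Q$ merge at time $k\ge1$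 if no path of $\tilde G[k-1]$ joins a node of $V_P$ to a node of $V_Q$, while $\tilde G[k]$ has an edge between $V_P$ and $V_Q$. Let $\mathcal X$ be the set of all $x[0]\in\mathbb R^V$ for which there is a time $\kappa=\kappa(x[0])\in\mathbb N$ such that: (a) there is $x_Q\in\mathbb R$ (depending on $x[0]$) with $x_i[k]=x_Q$ for all $i\in V_Q$ and all $0\le k\le\kappa$; (b) $V_P$ and $V_Q$ merge at time $\kappa$, and at no earlier time; (c) for every $0\le k<\kappa$, $V_P$ is the vertex set of a connected component of $\tilde G[k]$, i.e. $G_P[k]$ is connected and $\tilde G[k]$ has no edge between $V_P$ and $V\setminus V_P$; (d) no link within $V_P$ breaks before time $\kappa$, i.e. for $1\le k<\kappa$ every edge of $G_P[k-1]$ is an edge of $G_P[k]$. If $\sup_{x[0]\in\mathcal X}\kappa(x[0])=\infty$, then there are $\lambda\in(0,1)$ and an eigenvector $v\in\mathbb R^{V_P}$ of $A_{P_0}$ for the eigenvalue $\lambda$ such that $v_i\ne0$ for some $i\in[l]$ and $v_iv_j\ge0$ for all $i,j\in[l]$. -/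

import Mathlib

open Matrix

namespace SocialHK

/-- The closed neighbourhood of `i`: every agent is a neighbour of itself. -/
def closedNbhd {W : Type*} (H : SimpleGraph W) (i : W) : Set W :=
  insert i (H.neighborSet i)

open Classical in
/-- The normalized adjacency matrix of `H` (with a self-loop at every node): row `i` is the uniform
probability distribution on the closed neighbourhood of `i`. -/
noncomputable def normalizedAdjacency {W : Type*} (H : SimpleGraph W) : Matrix W W ℝ :=
  fun i j => if j ∈ closedNbhd H i then ((closedNbhd H i).ncard : ℝ)⁻¹ else 0

variable {V : Type*}

/-- The influence graph of the state `x`: the edges of the physical graph `G` whose endpoints hold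
opinions at distance at most the confidence bound `R`. -/
def influenceGraph (G : SimpleGraph V) (R : ℝ) (x : V → ℝ) : SimpleGraph V where
  Adj i j := G.Adj i j ∧ |x i - x j| ≤ R
  symm := ⟨fun i j h => ⟨h.1.symm, by rw [abs_sub_comm]; exact h.2⟩⟩
  loopless := ⟨fun i h => G.loopless.irrefl i h.1⟩

/-- The social Hegselmann-Krause dynamics `x[k+1] = A[k] x[k]`, where `A[k]` is the normalized
adjacency matrix of the influence graph of `x[k]`: each agent moves to the average opinion of its
current neighbours, itself included. -/
noncomputable def state [Fintype V] (G : SimpleGraph V) (R : ℝ) (x₀ : V → ℝ) : ℕ → V → ℝ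
  | 0 => x₀
  | k + 1 =>
      normalizedAdjacency (influenceGraph G R (state G R x₀ k)) *ᵥ state G R x₀ k

/-- The influence graph at time `k` when the initial state is `x₀`. -/
noncomputable def graphAt [Fintype V] (G : SimpleGraph V) (R : ℝ) (x₀ : V → ℝ) (k : ℕ) :
    SimpleGraph V :=
  influenceGraph G R (state G R x₀ k)

/-- The link between `i` and `j` breaks at time `k`. -/
def LinkBreakAt [Fintype V] (G : SimpleGraph V) (R : ℝ) (x₀ : V → ℝ) (i j : V) (k : ℕ) : Prop :=
  1 ≤ k ∧ (graphAt G R x₀ (k - 1)).Adj i j ∧ ¬ (graphAt G R x₀ k).Adj i j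

/-- The subgraphs induced by `P` and `Q` merge at time `k`: they are disconnected from each other in
the influence graph at time `k - 1`, and some agent of `P` and some agent of `Q` are neighbours at
time `k`. -/
def MergeAt [Fintype V] (G : SimpleGraph V) (R : ℝ) (x₀ : V → ℝ) (P Q : Finset V) (k : ℕ) : Prop :=
  1 ≤ k ∧ (∀ i ∈ P, ∀ j ∈ Q, ¬ (graphAt G R x₀ (k - 1)).Reachable i j) ∧
    ∃ i ∈ P, ∃ j ∈ Q, (graphAt G R x₀ k).Adj i j

/-- The initial state `x₀` is admissible for `P` and `Q`, with first merging time `κ`. -/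
structure Admissible [Fintype V] (G : SimpleGraph V) (R : ℝ) (P Q : Finset V)
    (x₀ : V → ℝ) (κ : ℕ) : Prop where
  /-- `Q` starts at a consensus, whose value stays constant in time up to the merging time. -/
  consensus : ∃ xQ : ℝ, ∀ k ≤ κ, ∀ j ∈ Q, state G R x₀ k j = xQ
  merge : MergeAt G R x₀ P Q κ
  /-- The merging at time `κ` is the first one. -/
  first : ∀ k < κ, ¬ MergeAt G R x₀ P Q k
  connected : ∀ k < κ, ((graphAt G R x₀ k).induce (P : Set V)).Connected
  /-- Before the merging time, no agent of `P` has a neighbour outside `P`; together with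
  `connected`, this says that `P` is a connected component of the influence graph. -/
  isolated : ∀ k < κ, ∀ i ∈ P, ∀ j ∉ P, ¬ (graphAt G R x₀ k).Adj i j
  /-- No link between two agents of `P` breaks before the merging time. -/
  noBreak : ∀ k < κ, ∀ i ∈ P, ∀ j ∈ P, ¬ LinkBreakAt G R x₀ i j k

/-- The nodes of `P` that are adjacent in the physical graph to at least one node of `Q`. -/
def boundary (G : SimpleGraph V) (P Q : Finset V) : Set ↥(P : Set V) :=
  {i | ∃ j ∈ Q, G.Adj i j}

end SocialHK

/-! Late merging is incompatible with the absence of such an eigenvector. Up to the merging time the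
graphs on `P` contain their connected initial graph, so the spread in `P` contracts at a uniform
rate (`spread_contraction`) and is at most `R` from a time `T` independent of the initial state.
From `T` to the merging time every physical link within `P` is active and the dynamics is linear,
with the normalized adjacency matrix of `G.induce P`. Its eigenvalues lie in `(-1, 1]`, with only
constants at `1`, so each boundary opinion is a constant plus a sum of terms `λ ^ t * e_λ` with `|λ|
< 1` (`exists_spectral_expansion`).

Before merging, all boundary nodes lie farther than `R` from the consensus value of `Q`, on one and
the same side. Merging therefore means that, up to a global sign, such a sum reaches at a late time
a threshold that all boundary sums stayed below since `T`. If no eigenvector with eigenvalue in `(0,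
1)` is nonzero and one-signed on the boundary, `exists_nonpos_dominant` and compactness make every
nonzero family of sums exceed, at a bounded time, a fixed multiple of its norm. Late values are
smaller than that, so no late record occurs (`exists_bound_record_time`). -/

namespace SocialHK

/-! ### Exponential sums: dominant terms and late records. -/

/-- If all the exponential sums with coefficients `b` are nonpositive, then the dominant nonzero
coefficient belongs to a positive base and is nonpositive. -/
theorem exists_nonpos_dominant {ι L : Type*} [Fintype ι] (lam : ι → ℝ)
    (hinj : Function.Injective lam) (h0 : ∀ k, lam k ≠ 0) (b : ι → L → ℝ) (hb : b ≠ 0)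
    (hf : ∀ m, 1 ≤ m → ∀ i, ∑ k, lam k ^ m * b k i ≤ 0) :
    ∃ k, 0 < lam k ∧ b k ≠ 0 ∧ ∀ i, b k i ≤ 0 := by
  classical
  set K : Finset ι := Finset.univ.filter fun k => b k ≠ 0 with hK
  have hKne : K.Nonempty := by
    obtain ⟨k, hk⟩ := Function.ne_iff.1 hb
    exact ⟨k, by simpa [hK] using hk⟩
  obtain ⟨k₀, hk₀, hmax⟩ := K.exists_max_image (fun k => |lam k|) hKne
  set ρ := |lam k₀| with hρ
  have hρ0 : 0 < ρ := abs_pos.2 (h0 _)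
  set Sp : L → ℝ := fun i => ∑ k ∈ K, if lam k = ρ then b k i else 0 with hSp
  set Sm : L → ℝ := fun i => ∑ k ∈ K, if lam k = -ρ then b k i else 0 with hSm
  have hsum : ∀ m, 1 ≤ m → ∀ i, ∑ k ∈ K, (lam k / ρ) ^ m * b k i ≤ 0 := by
    intro m hm i
    have h1 : ∑ k ∈ K, lam k ^ m * b k i = ∑ k, lam k ^ m * b k i := by
      refine Finset.sum_subset (Finset.subset_univ _) fun k _ hk => ?_
      have : b k = 0 := by simpa [hK] using hk
      simp [this]
    have h2 : ∑ k ∈ K, (lam k / ρ) ^ m * b k i = (∑ k, lam k ^ m * b k i) / ρ ^ m := by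
      rw [← h1, Finset.sum_div]
      exact Finset.sum_congr rfl fun k _ => by rw [div_pow]; ring
    rw [h2]
    exact div_nonpos_of_nonpos_of_nonneg (hf m hm i) (by positivity)
  have hneg : -ρ ≠ ρ := by linarith
  -- After rescaling by the largest modulus `ρ`, only the bases `ρ` and `-ρ` survive in the limit.
  have hterm : ∀ k ∈ K, ∀ i, Filter.Tendsto (fun p : ℕ => ((lam k / ρ) ^ 2) ^ p * b k i)
      Filter.atTop (nhds ((if lam k = ρ then b k i else 0) + if lam k = -ρ then b k i else 0)) := by
    intro k hk i
    have hle : |lam k| ≤ ρ := hmax k hk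
    by_cases h1 : lam k = ρ
    · simp [h1, hρ0.ne', hneg.symm]
    by_cases h2 : lam k = -ρ
    · simp [h2, hρ0.ne', hneg]
    have hlt : |lam k| < ρ := by
      refine lt_of_le_of_ne hle fun h => ?_
      rcases (abs_eq hρ0.le).1 h with h | h
      · exact h1 h
      · exact h2 h
    have hr : (lam k / ρ) ^ 2 < 1 := by
      rw [div_pow, div_lt_one (by positivity)]
      exact sq_lt_sq.2 (by rwa [abs_of_pos hρ0])
    simpa [h1, h2] using
      (tendsto_pow_atTop_nhds_zero_of_lt_one (sq_nonneg _) hr).mul_const (b k i)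
  have heven : ∀ i, Sp i + Sm i ≤ 0 := by
    intro i
    rw [hSp, hSm, ← Finset.sum_add_distrib]
    refine le_of_tendsto (tendsto_finsetSum K fun k hk => hterm k hk i) ?_
    filter_upwards [Filter.eventually_ge_atTop 1] with p hp
    simpa [← pow_mul] using hsum (2 * p) (by omega) i
  -- Odd exponents flip the sign of `Sm`; with `heven` this gives `|Sm i| ≤ -Sp i`, so `Sm` cannot
  -- be nonzero without `Sp`.
  have hodd : ∀ i, Sp i - Sm i ≤ 0 := by
    intro i
    have hlim := tendsto_finsetSum K fun k hk => (hterm k hk i).const_mul (lam k / ρ)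
    have heq : Sp i - Sm i = ∑ k ∈ K, lam k / ρ *
        ((if lam k = ρ then b k i else 0) + if lam k = -ρ then b k i else 0) := by
      rw [hSp, hSm, ← Finset.sum_sub_distrib]
      refine Finset.sum_congr rfl fun k _ => ?_
      by_cases h1 : lam k = ρ
      · simp [h1, hρ0.ne', hneg.symm]
      by_cases h2 : lam k = -ρ
      · simp [h2, hρ0.ne', hneg]
      simp [h1, h2]
    rw [heq]
    refine le_of_tendsto hlim (Filter.Eventually.of_forall fun p => ?_)
    have := hsum (2 * p + 1) (by omega) i
    refine le_of_eq_of_le (Finset.sum_congr rfl fun k _ => ?_) this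
    rw [← pow_mul]; ring
  have hsingle : ∀ (r : ℝ) (k : ι), k ∈ K → lam k = r → ∀ i,
      (∑ k ∈ K, if lam k = r then b k i else 0) = b k i := by
    intro r k hk hkr i
    rw [Finset.sum_eq_single k]
    · simp [hkr]
    · intro k' _ hne
      rw [if_neg]
      exact fun h => hne (hinj (h.trans hkr.symm))
    · exact fun h => absurd hk h
  by_cases hex : ∃ k ∈ K, lam k = ρ
  · obtain ⟨k, hk, hkρ⟩ := hex
    refine ⟨k, hkρ ▸ hρ0, by simpa [hK] using hk, fun i => ?_⟩
    have h1 := hsingle ρ k hk hkρ i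
    have h2 := heven i
    have h3 := hodd i
    have h4 : Sp i = b k i := h1
    linarith
  · exfalso
    push Not at hex
    have hk0 : lam k₀ = -ρ := by
      rcases (abs_eq hρ0.le).1 (rfl : |lam k₀| = ρ) with h | h
      · exact absurd h (hex _ hk₀)
      · exact h
    have hb0 : b k₀ ≠ 0 := by simpa [hK] using hk₀
    refine hb0 (funext fun i => ?_)
    have h0 : Sp i = 0 := Finset.sum_eq_zero fun k hk => if_neg (hex k hk)
    have h1 : Sm i = b k₀ i := hsingle _ _ hk₀ hk0 i
    have h2 := heven i
    have h3 := hodd i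
    show b k₀ i = 0
    linarith

/-- Unless some coefficient family in `B` has a nonzero nonpositive component at a positive base,
the exponential sums with coefficients in `B` cannot exceed all their earlier values at a late
time. -/
theorem exists_bound_record_time {ι L : Type*} [Fintype ι] [Fintype L] (lam : ι → ℝ)
    (hinj : Function.Injective lam) (h0 : ∀ k, lam k ≠ 0) (h1 : ∀ k, |lam k| < 1)
    (B : Submodule ℝ (ι → L → ℝ))
    (hB : ∀ b ∈ B, ∀ k, 0 < lam k → b k ≠ 0 → ¬ ∀ i, b k i ≤ 0) :
    ∃ N : ℕ, ∀ M, N ≤ M → ∀ b ∈ B, ∀ γ : ℝ,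
      (∀ m, 1 ≤ m → m < M → ∀ i, ∑ k, lam k ^ m * b k i < γ) →
        ∀ i, ∑ k, lam k ^ M * b k i < γ := by
  classical
  set f : ℕ → L → (ι → L → ℝ) → ℝ := fun m i b => ∑ k, lam k ^ m * b k i with hf
  have hfc : ∀ m i, Continuous (f m i) := fun m i => by fun_prop
  have hcomp : IsCompact (Metric.sphere (0 : ι → L → ℝ) 1 ∩ (B : Set (ι → L → ℝ))) :=
    (isCompact_sphere _ _).inter_right B.closed_of_finiteDimensional
  -- A single `N` bounds both the time and the inverse height, so the cover is increasing and
  -- compactness yields one `N` for the whole unit sphere of `B`.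
  set U : ℕ → Set (ι → L → ℝ) := fun N => ⋃ m ∈ Finset.Icc 1 N, ⋃ i, {b | 1 / ((N : ℝ) + 1) < f m i b}
    with hU
  have hUo : ∀ N, IsOpen (U N) := fun N =>
    isOpen_biUnion fun m _ => isOpen_iUnion fun i => isOpen_lt continuous_const (hfc m i)
  have hUmono : Monotone U := by
    intro N N' hN b hb
    simp only [hU, Set.mem_iUnion, Finset.mem_Icc, Set.mem_ofPred_eq, exists_prop] at hb ⊢
    obtain ⟨m, hm, i, hi⟩ := hb
    exact ⟨m, ⟨hm.1, hm.2.trans hN⟩, i, (Nat.one_div_le_one_div hN).trans_lt hi⟩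
  obtain ⟨N, hN⟩ := hcomp.elim_directed_cover U hUo (by
    rintro b ⟨hb1, hb⟩
    have hb0 : b ≠ 0 := by
      rintro rfl
      simp at hb1
    by_contra hcon
    have hle : ∀ m, 1 ≤ m → ∀ i, ∑ k, lam k ^ m * b k i ≤ 0 := by
      intro m hm i
      by_contra hpos
      obtain ⟨n, hn⟩ := exists_nat_one_div_lt (not_le.1 hpos)
      apply hcon
      simp only [hU, Set.mem_iUnion, Finset.mem_Icc, Set.mem_ofPred_eq, exists_prop]
      exact ⟨max m n, m, ⟨hm, le_max_left _ _⟩, i,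
        (Nat.one_div_le_one_div (le_max_right _ _)).trans_lt hn⟩
    obtain ⟨k, hk, hbk, hneg⟩ := exists_nonpos_dominant lam hinj h0 b hb0 hle
    exact hB b hb k hk hbk hneg) hUmono.directed_le
  have hlim : Filter.Tendsto (fun M : ℕ => ∑ k, |lam k| ^ M) Filter.atTop (nhds 0) := by
    simpa using tendsto_finsetSum (Finset.univ : Finset ι) fun k _ =>
      tendsto_pow_atTop_nhds_zero_of_lt_one (abs_nonneg (lam k)) (h1 k)
  obtain ⟨M₀, hM₀⟩ := Filter.eventually_atTop.1
    (hlim.eventually (gt_mem_nhds (Nat.one_div_pos_of_nat : 0 < 1 / ((N : ℝ) + 1))))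
  -- `M₀` makes the sums at time `M` smaller than `‖b‖ / (N + 1)`; `N + 2` puts the times `m ≤ N`,
  -- and time `1` when `b = 0`, strictly before `M`.
  refine ⟨max M₀ (N + 2), fun M hM b hb γ hγ i => ?_⟩
  have hMM : M₀ ≤ M := (le_max_left _ _).trans hM
  have hMN : N + 2 ≤ M := (le_max_right _ _).trans hM
  by_cases hb0 : b = 0
  · have := hγ 1 le_rfl (by omega) i
    subst hb0
    simpa using this
  have hnorm : 0 < ‖b‖ := norm_pos_iff.2 hb0
  have hmem : ‖b‖⁻¹ • b ∈ Metric.sphere (0 : ι → L → ℝ) 1 ∩ (B : Set (ι → L → ℝ)) := by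
    refine ⟨?_, B.smul_mem _ hb⟩
    simp [norm_smul, hnorm.ne']
  have hin := hN hmem
  simp only [hU, Set.mem_iUnion, Finset.mem_Icc, Set.mem_ofPred_eq, exists_prop] at hin
  obtain ⟨m, hm, j, hj⟩ := hin
  have hsc : f m j (‖b‖⁻¹ • b) = ‖b‖⁻¹ * f m j b := by
    simp only [hf, Finset.mul_sum, Pi.smul_apply, smul_eq_mul]
    exact Finset.sum_congr rfl fun k _ => by ring
  rw [hsc, ← div_eq_inv_mul, lt_div_iff₀ hnorm] at hj
  have hup : f M i b ≤ (∑ k, |lam k| ^ M) * ‖b‖ := by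
    rw [hf, Finset.sum_mul]
    refine Finset.sum_le_sum fun k _ => ?_
    refine (le_abs_self _).trans ?_
    rw [abs_mul, abs_pow]
    gcongr
    exact (norm_le_pi_norm (b k) i).trans (norm_le_pi_norm b k)
  have h3 := hγ m hm.1 (by omega) j
  have h4 := mul_lt_mul_of_pos_right (hM₀ M hMM) hnorm
  exact (hup.trans_lt (h4.trans hj)).trans h3


/-! ### The averaging operator of a graph: maximum principle and spectrum. -/

theorem self_mem_closedNbhd {W : Type*} (H : SimpleGraph W) (i : W) : i ∈ closedNbhd H i :=
  Set.mem_insert _ _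

theorem mem_closedNbhd_of_adj {W : Type*} {H : SimpleGraph W} {i j : W} (h : H.Adj i j) :
    j ∈ closedNbhd H i :=
  Set.mem_insert_of_mem _ h

theorem mem_closedNbhd_comm {W : Type*} (H : SimpleGraph W) (i j : W) :
    j ∈ closedNbhd H i ↔ i ∈ closedNbhd H j := by
  simp only [closedNbhd, Set.mem_insert_iff, SimpleGraph.mem_neighborSet, H.adj_comm i j,
    eq_comm (a := j)]

theorem normalizedAdjacency_nonneg {W : Type*} (H : SimpleGraph W) (i j : W) :
    0 ≤ normalizedAdjacency H i j := by
  unfold normalizedAdjacency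
  split_ifs <;> positivity

section Finite

variable {W : Type*} [Fintype W]

theorem ncard_closedNbhd_pos (H : SimpleGraph W) (i : W) :
    (0 : ℝ) < (closedNbhd H i).ncard := by
  exact_mod_cast (Set.ncard_pos (Set.toFinite _)).2 ⟨i, self_mem_closedNbhd H i⟩

theorem normalizedAdjacency_mulVec_const (H : SimpleGraph W) (c : ℝ) :
    normalizedAdjacency H *ᵥ (fun _ => c) = fun _ => c := by
  classical
  funext i
  have h := (ncard_closedNbhd_pos H i).ne'
  have hc : (((Finset.univ.filter fun j => j ∈ closedNbhd H i).card : ℕ) : ℝ)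
      = (closedNbhd H i).ncard := by
    rw [← Set.ncard_coe_finset]
    congr 2
    ext; simp
  simp only [mulVec, dotProduct, normalizedAdjacency, ite_mul, zero_mul]
  rw [← Finset.sum_filter, Finset.sum_const, nsmul_eq_mul, hc]
  field_simp

/-- Nonzero weights are at least `1 / |W|`, and the other terms are nonnegative. Applied to `c - y`,
this gives the maximum principle and the contraction rate. -/
theorem le_normalizedAdjacency_mulVec (H : SimpleGraph W) {g : W → ℝ} (hg : ∀ j, 0 ≤ g j)
    {i j : W} (hj : j ∈ closedNbhd H i) :
    g j / Fintype.card W ≤ (normalizedAdjacency H *ᵥ g) i := by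
  have h1 : normalizedAdjacency H i j * g j ≤ (normalizedAdjacency H *ᵥ g) i :=
    Finset.single_le_sum (f := fun j => normalizedAdjacency H i j * g j)
      (fun k _ => mul_nonneg (normalizedAdjacency_nonneg H i k) (hg k)) (Finset.mem_univ j)
  refine le_trans ?_ h1
  rw [normalizedAdjacency, if_pos hj, div_eq_inv_mul]
  refine mul_le_mul_of_nonneg_right ?_ (hg j)
  refine inv_anti₀ (ncard_closedNbhd_pos H i) ?_
  rw [← Nat.card_eq_fintype_card, ← Set.ncard_univ]
  exact_mod_cast Set.ncard_le_ncard (Set.subset_univ _) Set.finite_univ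

theorem normalizedAdjacency_mulVec_const_sub (H : SimpleGraph W) (c : ℝ) (y : W → ℝ) (i : W) :
    (normalizedAdjacency H *ᵥ fun j => c - y j) i = c - (normalizedAdjacency H *ᵥ y) i := by
  have : (fun j => c - y j) = (fun _ => c) - y := rfl
  rw [this, mulVec_sub, normalizedAdjacency_mulVec_const]
  rfl

theorem normalizedAdjacency_mulVec_le (H : SimpleGraph W) {y : W → ℝ} {c : ℝ}
    (hy : ∀ j, y j ≤ c) (i : W) : (normalizedAdjacency H *ᵥ y) i ≤ c := by
  have h := le_normalizedAdjacency_mulVec H (g := fun j => c - y j)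
    (fun j => sub_nonneg.2 (hy j)) (self_mem_closedNbhd H i)
  rw [normalizedAdjacency_mulVec_const_sub] at h
  have : 0 ≤ (c - y i) / Fintype.card W := div_nonneg (sub_nonneg.2 (hy i)) (Nat.cast_nonneg _)
  linarith

theorem le_normalizedAdjacency_mulVec_of_le (H : SimpleGraph W) {y : W → ℝ} {c : ℝ}
    (hy : ∀ j, c ≤ y j) (i : W) : c ≤ (normalizedAdjacency H *ᵥ y) i := by
  have h := normalizedAdjacency_mulVec_le H (y := -y) (c := -c) (fun j => neg_le_neg (hy j)) i
  rw [mulVec_neg] at h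
  exact neg_le_neg_iff.1 h

/-- A maximum principle: eigenvalues lie in `(-1, 1]`, and an eigenvector for `1` is constant. -/
theorem eigenvector_maximum_principle {H : SimpleGraph W} (hH : H.Connected) {μ : ℝ} {v : W → ℝ}
    (hv : normalizedAdjacency H *ᵥ v = μ • v) (hv0 : v ≠ 0) :
    -1 < μ ∧ μ ≤ 1 ∧ (μ = 1 → ∃ c, v = fun _ => c) := by
  classical
  obtain ⟨i₀, hi₀⟩ := Function.ne_iff.1 hv0
  have : Nonempty W := ⟨i₀⟩
  obtain ⟨i, -, hi⟩ := Finset.univ.exists_max_image (fun j => |v j|) Finset.univ_nonempty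
  wlog hpos : 0 < v i generalizing v
  · have hi0 : 0 < |v i| := (abs_pos.2 hi₀).trans_le (hi i₀ (Finset.mem_univ _))
    have hneg : 0 < (-v) i := by
      rcases lt_or_gt_of_ne (abs_pos.1 hi0) with h | h
      · exact neg_pos.2 h
      · exact absurd h hpos
    obtain ⟨h1, h2, h3⟩ := this (v := -v) (by rw [mulVec_neg, hv, smul_neg]) (neg_ne_zero.2 hv0)
      (by simpa using hi₀) (by simpa using hi) hneg
    refine ⟨h1, h2, fun h => ?_⟩
    obtain ⟨c, hc⟩ := h3 h
    exact ⟨-c, by rw [← neg_neg v, hc]; rfl⟩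
  have habs : ∀ j, |v j| ≤ v i := fun j => by
    have := hi j (Finset.mem_univ _)
    rwa [abs_of_pos hpos] at this
  have hcard : (0 : ℝ) < Fintype.card W := by exact_mod_cast Fintype.card_pos
  have hsub : ∀ j, 0 ≤ v i - v j := fun j => sub_nonneg.2 ((le_abs_self _).trans (habs j))
  have hadd : ∀ j, 0 ≤ v i - (-v) j := fun j => by
    have := neg_le_of_abs_le (habs j)
    simp only [Pi.neg_apply]
    linarith
  have hev : ∀ j, (normalizedAdjacency H *ᵥ v) j = μ * v j := fun j => by rw [hv]; rfl
  have hstep : ∀ a b, b ∈ closedNbhd H a → (v i - v b) / Fintype.card W ≤ v i - μ * v a := by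
    intro a b hb
    have h := le_normalizedAdjacency_mulVec H hsub hb
    rwa [normalizedAdjacency_mulVec_const_sub, hev] at h
  refine ⟨?_, ?_, ?_⟩
  -- The self-loop excludes `-1`: at the maximizer `i` of `|v|`, the vector `v i + v` has average
  -- `(1 + μ) * v i`, at least its own share `2 * v i / |W| > 0`.
  · have h := le_normalizedAdjacency_mulVec H hadd (self_mem_closedNbhd H i)
    rw [normalizedAdjacency_mulVec_const_sub, mulVec_neg] at h
    simp only [Pi.neg_apply, hev] at h
    have h2 : 0 < (v i - -v i) / Fintype.card W := by
      apply div_pos _ hcard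
      linarith
    nlinarith
  · have h := hstep i i (self_mem_closedNbhd H i)
    rw [sub_self, zero_div] at h
    nlinarith
  · rintro rfl
    refine ⟨v i, funext fun j => ?_⟩
    obtain ⟨p⟩ := hH.preconnected j i
    induction p with
    | nil => rfl
    | cons hadj p ih =>
      have hc := ih hi hpos habs hsub hadd hstep
      have h := hstep _ _ (mem_closedNbhd_of_adj hadj.symm)
      rw [hc, one_mul, sub_self, div_le_iff₀ hcard, zero_mul] at h
      exact le_antisymm ((le_abs_self _).trans (habs _)) (by linarith)

/-- Conjugation by the square roots of the closed-neighbourhood sizes turns the matrix into a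
symmetric one, to which the spectral theorem applies. -/
theorem iSup_eigenspace_normalizedAdjacency (H : SimpleGraph W) :
    ⨆ μ, Module.End.eigenspace (normalizedAdjacency H).mulVecLin μ = ⊤ := by
  classical
  set d : W → ℝ := fun i => Real.sqrt (closedNbhd H i).ncard with hd
  have hd0 : ∀ i, d i ≠ 0 := fun i => (Real.sqrt_pos.2 (ncard_closedNbhd_pos H i)).ne'
  have hdd : ∀ i, ((closedNbhd H i).ncard : ℝ)⁻¹ = (d i)⁻¹ * (d i)⁻¹ := fun i => by
    rw [← mul_inv, hd, Real.mul_self_sqrt (Nat.cast_nonneg _)]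
  set S : Matrix W W ℝ := fun i j => if j ∈ closedNbhd H i then (d i)⁻¹ * (d j)⁻¹ else 0 with hS
  have hSh : S.IsHermitian := by
    ext i j
    rw [conjTranspose_apply, star_trivial]
    simp only [hS, mem_closedNbhd_comm H j i, mul_comm (d j)⁻¹]
  have hconj : ∀ u : W → ℝ, normalizedAdjacency H *ᵥ (fun j => (d j)⁻¹ * u j) =
      fun i => (d i)⁻¹ * (S *ᵥ u) i := by
    intro u
    funext i
    simp only [mulVec, dotProduct, Finset.mul_sum, hS, normalizedAdjacency]
    refine Finset.sum_congr rfl fun j _ => ?_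
    split_ifs
    · rw [hdd]; ring
    · ring
  rw [eq_top_iff]
  intro z _
  set w : EuclideanSpace ℝ W := WithLp.toLp 2 fun i => d i * z i with hw
  have hz : z = ∑ k, hSh.eigenvectorBasis.repr w k •
      fun i => (d i)⁻¹ * hSh.eigenvectorBasis k i := by
    funext i
    have h1 : w i = ∑ k, hSh.eigenvectorBasis.repr w k * hSh.eigenvectorBasis k i := by
      conv_lhs => rw [← hSh.eigenvectorBasis.sum_repr w]
      simp
    have h2 : w i = d i * z i := rfl
    have h3 : z i = (d i)⁻¹ * w i := by rw [h2, inv_mul_cancel_left₀ (hd0 i)]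
    rw [h3, h1, Finset.mul_sum, Finset.sum_apply]
    refine Finset.sum_congr rfl fun k _ => ?_
    simp only [Pi.smul_apply, smul_eq_mul]
    ring
  rw [hz]
  refine Submodule.sum_mem _ fun k _ => Submodule.smul_mem _ _ ?_
  refine Submodule.mem_iSup_of_mem (hSh.eigenvalues k) ?_
  rw [Module.End.mem_eigenspace_iff, mulVecLin_apply, hconj, hSh.mulVec_eigenvectorBasis]
  funext i
  simp only [Pi.smul_apply, smul_eq_mul]
  ring

/-- The constant `c` is the component at eigenvalue `1`. Eigenvalue `0` is left out of `s`, which is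
why `1 ≤ m` is required. -/
theorem exists_spectral_expansion {H : SimpleGraph W} (hH : H.Connected) :
    ∃ s : Finset ℝ, (∀ μ ∈ s, μ ≠ 0 ∧ |μ| < 1) ∧ ∀ z : W → ℝ, ∃ (c : ℝ) (e : s → W → ℝ),
      (∀ k : s, normalizedAdjacency H *ᵥ e k = (k : ℝ) • e k) ∧
      ∀ m, 1 ≤ m → ((normalizedAdjacency H).mulVecLin ^ m) z =
        fun i => c + ∑ k : s, (k : ℝ) ^ m * e k i := by
  classical
  set T : Module.End ℝ (W → ℝ) := (normalizedAdjacency H).mulVecLin with hT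
  have := hH.nonempty
  have hbound : ∀ μ, T.HasEigenvalue μ → -1 < μ ∧ μ ≤ 1 := by
    intro μ hμ
    obtain ⟨v, hv⟩ := hμ.exists_hasEigenvector
    have := eigenvector_maximum_principle hH (by simpa [hT] using hv.apply_eq_smul) hv.2
    exact ⟨this.1, this.2.1⟩
  have hfin : {μ | T.HasEigenvalue μ}.Finite := T.finite_hasEigenvalue
  set s := hfin.toFinset.filter fun μ => μ ≠ 0 ∧ μ ≠ 1 with hs
  refine ⟨s, ?_, fun z => ?_⟩
  · intro μ hμ
    simp only [hs, Finset.mem_filter, Set.Finite.mem_toFinset, Set.mem_ofPred_eq] at hμ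
    obtain ⟨h1, h2, h3⟩ := hμ
    obtain ⟨h4, h5⟩ := hbound μ h1
    exact ⟨h2, abs_lt.2 ⟨h4, lt_of_le_of_ne h5 h3⟩⟩
  have hz : z ∈ ⨆ μ, T.eigenspace μ := by
    rw [hT, iSup_eigenspace_normalizedAdjacency]; trivial
  obtain ⟨f, hf, hfz⟩ := (Submodule.mem_iSup_iff_exists_finsupp _ _).1 hz
  have hTf : ∀ μ, T (f μ) = μ • f μ := fun μ => Module.End.mem_eigenspace_iff.1 (hf μ)
  have hTpow : ∀ μ (m : ℕ), (T ^ m) (f μ) = μ ^ m • f μ := by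
    intro μ m
    induction m with
    | zero => simp
    | succ m ih => rw [pow_succ', Module.End.mul_apply, ih, map_smul, hTf, smul_smul, pow_succ]
  have hconst : ∃ c, f 1 = fun _ => c := by
    by_cases h0 : f 1 = 0
    · exact ⟨0, h0⟩
    · exact (eigenvector_maximum_principle hH (by simpa [hT] using hTf 1) h0).2.2 rfl
  obtain ⟨c, hc⟩ := hconst
  refine ⟨c, fun k => f k, fun k => by simpa [hT] using hTf k, fun m hm => ?_⟩
  have hsub : f.support ⊆ hfin.toFinset := by
    intro μ hμ
    rw [Set.Finite.mem_toFinset]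
    exact Module.End.hasEigenvalue_of_hasEigenvector ⟨hf μ, by simpa using hμ⟩
  have h1 : (T ^ m) z = ∑ μ ∈ hfin.toFinset, μ ^ m • f μ := by
    rw [← hfz, Finsupp.sum, map_sum]
    rw [← Finset.sum_subset hsub]
    · exact Finset.sum_congr rfl fun μ _ => hTpow μ m
    · intro μ _ hμ
      rw [Finsupp.notMem_support_iff.1 hμ, smul_zero]
  have h2 : ∑ μ ∈ hfin.toFinset.filter (fun μ => ¬ (μ ≠ 0 ∧ μ ≠ 1)), μ ^ m • f μ = f 1 := by
    rw [Finset.sum_eq_single 1]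
    · simp
    · intro μ hμ hne
      simp only [Finset.mem_filter, not_and, not_not] at hμ
      have : μ = 0 := by
        by_contra h
        exact hne (hμ.2 h)
      rw [this, zero_pow (by omega), zero_smul]
    · intro h
      rw [one_pow, one_smul]
      by_contra hne
      exact h (by
        simp only [Finset.mem_filter, not_and, not_not, implies_true, and_true]
        exact hsub (by simpa using hne))
  rw [h1, ← Finset.sum_filter_add_sum_filter_not _ (fun μ => μ ≠ 0 ∧ μ ≠ 1), h2, hc, ← hs,
    ← Finset.sum_coe_sort]
  funext i
  simp [add_comm]

/-! ### Uniform contraction of the spread. -/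

/-- Averaging over graphs that all contain a connected graph contracts the spread of the state:
propagation of a low value along that graph. -/
theorem propagation {H₀ : SimpleGraph W} {H : ℕ → SimpleGraph W} {y : ℕ → W → ℝ} {K : ℕ}
    (hle : ∀ k < K, H₀ ≤ H k) (hy : ∀ k < K, y (k + 1) = normalizedAdjacency (H k) *ᵥ y k)
    {k : ℕ} {c : ℝ} (hc : ∀ j, y k j ≤ c) {i : W} :
    ∀ t, k + t ≤ K → (∀ j, y (k + t) j ≤ c) ∧ ∀ j (p : H₀.Walk j i), p.length ≤ t →
      (c - y k i) / (Fintype.card W : ℝ) ^ t ≤ c - y (k + t) j := by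
  intro t
  have hcard : (1 : ℝ) ≤ Fintype.card W := by
    exact_mod_cast Fintype.card_pos_iff.2 ⟨i⟩
  induction t with
  | zero =>
    refine fun _ => ⟨hc, fun j p hp => ?_⟩
    have := SimpleGraph.Walk.eq_of_length_eq_zero (Nat.le_zero.1 hp)
    simp [this]
  | succ t ih =>
    intro hK
    obtain ⟨h1, h2⟩ := ih (by omega)
    rw [← add_assoc, hy (k + t) (by omega)]
    refine ⟨fun j => normalizedAdjacency_mulVec_le _ h1 j, fun j p hp => ?_⟩
    have key : ∀ a, a ∈ closedNbhd (H (k + t)) j → ∀ q : H₀.Walk a i, q.length ≤ t →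
        (c - y k i) / (Fintype.card W : ℝ) ^ (t + 1) ≤
          c - (normalizedAdjacency (H (k + t)) *ᵥ y (k + t)) j := by
      intro a ha q hq
      have h3 := le_normalizedAdjacency_mulVec (H (k + t)) (g := fun j => c - y (k + t) j)
        (fun j => sub_nonneg.2 (h1 j)) ha
      rw [normalizedAdjacency_mulVec_const_sub] at h3
      refine le_trans ?_ h3
      rw [pow_succ, ← div_div]
      exact div_le_div_of_nonneg_right (h2 a q hq) (by linarith)
    cases p with
    | nil => exact key _ (self_mem_closedNbhd _ _) SimpleGraph.Walk.nil (Nat.zero_le _)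
    | cons h q =>
      exact key _ (mem_closedNbhd_of_adj (hle (k + t) (by omega) h)) q
        (by simpa using hp)

/-- Paths have fewer than `n = |W|` edges, so within `n` steps the minimizer pulls every node below
the old maximum by at least `1 / n ^ n` of the spread, while no value falls below the old minimum.
-/
theorem spread_contraction {H₀ : SimpleGraph W} (hH₀ : H₀.Connected) {H : ℕ → SimpleGraph W}
    {y : ℕ → W → ℝ} {K : ℕ} (hle : ∀ k < K, H₀ ≤ H k)
    (hy : ∀ k < K, y (k + 1) = normalizedAdjacency (H k) *ᵥ y k)
    {k : ℕ} {D : ℝ} (hD : ∀ i j, y k i - y k j ≤ D) (hk : k + Fintype.card W ≤ K) (i j : W) :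
    y (k + Fintype.card W) i - y (k + Fintype.card W) j ≤
      (1 - 1 / (Fintype.card W : ℝ) ^ Fintype.card W) * D := by
  classical
  have := hH₀.nonempty
  set n := Fintype.card W with hn
  have hcard : (1 : ℝ) ≤ n := by exact_mod_cast Fintype.card_pos
  obtain ⟨a, -, ha⟩ := Finset.univ.exists_min_image (y k) Finset.univ_nonempty
  obtain ⟨b, -, hb⟩ := Finset.univ.exists_max_image (y k) Finset.univ_nonempty
  obtain ⟨q⟩ := hH₀.preconnected i a
  obtain ⟨-, h1⟩ := propagation hle hy (fun j => hb j (Finset.mem_univ _)) (i := a) n hk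
  have h2 := h1 i q.toPath (q.toPath.2.length_lt.le)
  have h3 : ∀ t, k + t ≤ K → ∀ j, y k a ≤ y (k + t) j := by
    intro t
    induction t with
    | zero => exact fun _ j => ha j (Finset.mem_univ _)
    | succ t ih =>
      intro hK j
      rw [← add_assoc, hy (k + t) (by omega)]
      exact le_normalizedAdjacency_mulVec_of_le _ (ih (by omega)) j
  have h4 := h3 n hk j
  have h5 : y (k + n) i - y (k + n) j ≤ (1 - 1 / (n : ℝ) ^ n) * (y k b - y k a) := by
    have : (1 - 1 / (n : ℝ) ^ n) * (y k b - y k a) =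
      y k b - y k a - (y k b - y k a) / (n : ℝ) ^ n := by ring
    rw [this]
    linarith
  refine h5.trans (mul_le_mul_of_nonneg_left (hD b a) ?_)
  rw [sub_nonneg]
  exact div_le_one_of_le₀ (one_le_pow₀ hcard) (by positivity)

theorem spread_contraction_iterate {H₀ : SimpleGraph W} (hH₀ : H₀.Connected)
    {H : ℕ → SimpleGraph W} {y : ℕ → W → ℝ} {K : ℕ} (hle : ∀ k < K, H₀ ≤ H k)
    (hy : ∀ k < K, y (k + 1) = normalizedAdjacency (H k) *ᵥ y k)
    {D : ℝ} (hD : ∀ i j, y 0 i - y 0 j ≤ D) (r : ℕ) (hr : r * Fintype.card W ≤ K) (i j : W) :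
    y (r * Fintype.card W) i - y (r * Fintype.card W) j ≤
      (1 - 1 / (Fintype.card W : ℝ) ^ Fintype.card W) ^ r * D := by
  induction r generalizing i j with
  | zero => simpa using hD i j
  | succ r ih =>
    rw [Nat.succ_mul] at hr ⊢
    refine (spread_contraction hH₀ hle hy (ih (by omega)) hr i j).trans_eq ?_
    ring

end Finite


/-! ### The dynamics on `P` before merging. -/

theorem normalizedAdjacency_mulVec_induce {V : Type*} [Fintype V] (H : SimpleGraph V) (S : Set V)
    [Fintype S] (hS : ∀ i ∈ S, ∀ j ∉ S, ¬ H.Adj i j) (x : V → ℝ) (i : S) :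
    (normalizedAdjacency H *ᵥ x) i = (normalizedAdjacency (H.induce S) *ᵥ fun j => x j) i := by
  classical
  have hmem : ∀ j : S, (j : V) ∈ closedNbhd H i ↔ j ∈ closedNbhd (H.induce S) i := fun j => by
    simp [closedNbhd, Subtype.ext_iff]
  have hout : ∀ j ∉ S, j ∉ closedNbhd H i := by
    intro j hj h
    rcases h with h | h
    · exact hj (h ▸ i.2)
    · exact hS i i.2 j hj h
  have himage : closedNbhd H i = Subtype.val '' closedNbhd (H.induce S) i := by
    ext j
    refine ⟨fun h => ?_, ?_⟩
    · have hj : j ∈ S := by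
        by_contra hj
        exact hout j hj h
      exact ⟨⟨j, hj⟩, (hmem ⟨j, hj⟩).1 h, rfl⟩
    · rintro ⟨j, hj, rfl⟩
      exact (hmem j).2 hj
  have hcard : (closedNbhd H i).ncard = (closedNbhd (H.induce S) i).ncard := by
    rw [himage, Set.ncard_image_of_injective _ Subtype.val_injective]
  symm
  refine Fintype.sum_of_injective (Subtype.val : S → V) Subtype.val_injective _ _ ?_ ?_
  · intro j hj
    have hjS : j ∉ S := by simpa using hj
    simp [normalizedAdjacency, hout j hjS]
  · intro j
    simp only [normalizedAdjacency, hcard]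
    exact congrArg (· * x j) (if_congr (hmem j).symm rfl rfl)

theorem influenceGraph_induce_spread {V : Type*} {G : SimpleGraph V} {R : ℝ} {x : V → ℝ}
    {S : Set V} {i j : S} (p : ((influenceGraph G R x).induce S).Walk i j) :
    x i - x j ≤ p.length * R := by
  induction p with
  | nil => simp
  | cons h p ih =>
    have h1 := (le_abs_self _).trans h.2
    simp only [Function.Embedding.subtype_apply] at h1
    rw [SimpleGraph.Walk.length_cons]
    push_cast
    linarith

section Admissible

variable {V : Type*} [Fintype V] {G : SimpleGraph V} {R : ℝ} {P Q : Finset V} {x₀ : V → ℝ} {κ : ℕ}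

theorem Admissible.state_succ (h : Admissible G R P Q x₀ κ) {k : ℕ} (hk : k < κ) :
    (fun i : ↥(P : Set V) => state G R x₀ (k + 1) i) =
      normalizedAdjacency ((graphAt G R x₀ k).induce (P : Set V)) *ᵥ
        fun i : ↥(P : Set V) => state G R x₀ k i := by
  funext i
  exact normalizedAdjacency_mulVec_induce (graphAt G R x₀ k) (P : Set V)
    (fun i hi j hj => h.isolated k hk i (by simpa using hi) j (by simpa using hj)) _ i

theorem Admissible.induce_mono (h : Admissible G R P Q x₀ κ) {k : ℕ} (hk : k < κ) :
    (graphAt G R x₀ 0).induce (P : Set V) ≤ (graphAt G R x₀ k).induce (P : Set V) := by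
  induction k with
  | zero => exact le_rfl
  | succ k ih =>
    refine (ih (by omega)).trans fun i j hij => ?_
    by_contra hcon
    exact h.noBreak (k + 1) hk i (by simp) j (by simp)
      ⟨by omega, hij, hcon⟩

/-- Initial connectedness bounds the starting spread by `|P| * R`, uniformly in the initial state,
since each link spans at most `R`. -/
theorem Admissible.spread_le (h : Admissible G R P Q x₀ κ) (hR : 0 < R) (r : ℕ)
    (hr : r * Fintype.card ↥(P : Set V) ≤ κ) (i j : ↥(P : Set V)) :
    state G R x₀ (r * Fintype.card ↥(P : Set V)) i - state G R x₀ (r * Fintype.card ↥(P : Set V)) j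
      ≤ (1 - 1 / (Fintype.card ↥(P : Set V) : ℝ) ^ Fintype.card ↥(P : Set V)) ^ r *
        (Fintype.card ↥(P : Set V) * R) := by
  classical
  have hκ : 0 < κ := h.merge.1
  have hconn := h.connected 0 hκ
  refine spread_contraction_iterate hconn
    (H := fun k => (graphAt G R x₀ k).induce (P : Set V))
    (y := fun k i => state G R x₀ k i) (fun k hk => h.induce_mono hk)
    (fun k hk => h.state_succ hk) (fun i j => ?_) r hr i j
  obtain ⟨p⟩ := hconn.preconnected i j
  refine (influenceGraph_induce_spread p.toPath.1).trans ?_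
  have := p.toPath.2.length_lt.le
  gcongr
  exact this

/-- Once the opinions in `P` are within the confidence bound of each other they stay in the same
interval, and follow the dynamics of the physical graph on `P`. -/
theorem Admissible.linear_regime (h : Admissible G R P Q x₀ κ) {T : ℕ}
    (hT : ∀ i j : ↥(P : Set V), state G R x₀ T i - state G R x₀ T j ≤ R) :
    ∀ t, T + t ≤ κ →
      (∀ i j : ↥(P : Set V), |state G R x₀ (T + t) i - state G R x₀ T j| ≤ R) ∧
      (fun i : ↥(P : Set V) => state G R x₀ (T + t) i) =
        ((normalizedAdjacency (G.induce (P : Set V))).mulVecLin ^ t)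
          fun i : ↥(P : Set V) => state G R x₀ T i := by
  classical
  have hbd : ∀ t, T + t ≤ κ → ∃ a b : ↥(P : Set V), ∀ i : ↥(P : Set V),
      (∀ j : ↥(P : Set V), state G R x₀ T a ≤ state G R x₀ T j ∧
        state G R x₀ T j ≤ state G R x₀ T b) ∧
      state G R x₀ T a ≤ state G R x₀ (T + t) i ∧ state G R x₀ (T + t) i ≤ state G R x₀ T b := by
    have := (h.connected 0 h.merge.1).nonempty
    obtain ⟨a, -, ha⟩ := Finset.univ.exists_min_image
      (fun i : ↥(P : Set V) => state G R x₀ T i) Finset.univ_nonempty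
    obtain ⟨b, -, hb⟩ := Finset.univ.exists_max_image
      (fun i : ↥(P : Set V) => state G R x₀ T i) Finset.univ_nonempty
    have hab : ∀ j : ↥(P : Set V), state G R x₀ T a ≤ state G R x₀ T j ∧
        state G R x₀ T j ≤ state G R x₀ T b :=
      fun j => ⟨ha j (Finset.mem_univ _), hb j (Finset.mem_univ _)⟩
    intro t ht
    refine ⟨a, b, fun i => ⟨hab, ?_⟩⟩
    induction t generalizing i with
    | zero => exact hab i
    | succ t ih =>
      have hs := congrFun (h.state_succ (k := T + t) (by omega)) i
      rw [← add_assoc]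
      beta_reduce at hs
      rw [hs]
      exact ⟨le_normalizedAdjacency_mulVec_of_le _ (fun j => (ih (by omega) j).1) i,
        normalizedAdjacency_mulVec_le _ (fun j => (ih (by omega) j).2) i⟩
  intro t ht
  refine ⟨fun i j => ?_, ?_⟩
  · obtain ⟨a, b, hab⟩ := hbd t ht
    obtain ⟨h1, h2, h3⟩ := hab i
    have := hT b a
    rw [abs_le]
    constructor <;> linarith [(h1 j).1, (h1 j).2]
  · induction t with
    | zero => rfl
    | succ t ih =>
      -- All opinions remain in the time-`T` interval, of length at most `R`, so every physical link
      -- within `P` is active.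
      have hg : (graphAt G R x₀ (T + t)).induce (P : Set V) = G.induce (P : Set V) := by
        ext i j
        refine ⟨fun hij => hij.1, fun hij => ⟨hij, ?_⟩⟩
        obtain ⟨a, b, hab⟩ := hbd t (by omega)
        obtain ⟨-, h1, h2⟩ := hab i
        obtain ⟨-, h3, h4⟩ := hab j
        have := hT b a
        simp only [Function.Embedding.subtype_apply]
        rw [abs_le]
        constructor <;> linarith
      rw [← add_assoc, h.state_succ (by omega), hg, ih (by omega), pow_succ', Module.End.mul_apply,
        mulVecLin_apply]

theorem Admissible.far_from_consensus (h : Admissible G R P Q x₀ κ) (hPQ : Disjoint P Q) {xQ : ℝ}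
    (hQ : ∀ k ≤ κ, ∀ j ∈ Q, state G R x₀ k j = xQ) {k : ℕ} (hk : k < κ)
    {i : ↥(P : Set V)} (hi : i ∈ boundary G P Q) : R < |state G R x₀ k i - xQ| := by
  obtain ⟨j, hj, hij⟩ := hi
  by_contra hcon
  refine h.isolated k hk i (by simp) j (Finset.disjoint_right.1 hPQ hj) ⟨hij, ?_⟩
  rw [hQ k hk.le j hj]
  exact not_lt.1 hcon

end Admissible

end SocialHK

/-! ### Conclusion: a late merging would be a late record. -/

theorem mainTheorem3 {V : Type*} [Fintype V] (G : SimpleGraph V) (R : ℝ) (hR : 0 < R)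
    (P Q : Finset V) (hPQ : Disjoint P Q) (hP : (G.induce (P : Set V)).Connected)
    (hsup : ¬ BddAbove {κ : ℕ | ∃ x₀ : V → ℝ, SocialHK.Admissible G R P Q x₀ κ}) :
    ∃ (μ : ℝ) (v : ↥(P : Set V) → ℝ),
      Module.End.HasEigenvector
        (SocialHK.normalizedAdjacency (G.induce (P : Set V))).mulVecLin μ v ∧
      0 < μ ∧ μ < 1 ∧
      (∃ i ∈ SocialHK.boundary G P Q, v i ≠ 0) ∧
      ∀ i ∈ SocialHK.boundary G P Q, ∀ j ∈ SocialHK.boundary G P Q, 0 ≤ v i * v j := by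
  classical
  open SocialHK in
  by_contra hcon
  obtain ⟨s, hs, hexp⟩ := exists_spectral_expansion hP
  set A : Module.End ℝ (↥(P : Set V) → ℝ) :=
    (normalizedAdjacency (G.induce (P : Set V))).mulVecLin with hA
  -- Families of eigenvectors restricted to the boundary. `B` does not depend on the initial state,
  -- hence neither does `N`.
  set B : Submodule ℝ (s → boundary G P Q → ℝ) := Submodule.pi Set.univ fun k : s =>
    (A.eigenspace k).map (LinearMap.funLeft ℝ ℝ Subtype.val) with hBdef
  obtain ⟨N, hN⟩ := exists_bound_record_time (fun k : s => (k : ℝ)) Subtype.val_injective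
    (fun k => (hs k k.2).1) (fun k => (hs k k.2).2) B (by
      intro b hb k hk hbk hneg
      obtain ⟨u, hu, hub⟩ := Submodule.mem_map.1 (Submodule.mem_pi.1 hb k (Set.mem_univ _))
      obtain ⟨i, hi⟩ := Function.ne_iff.1 hbk
      have hbu : ∀ i, b k i = u i := fun i => by rw [← hub]; rfl
      have hui : u i ≠ 0 := by rw [← hbu]; exact hi
      refine hcon ⟨k, u, ⟨hu, fun h0 => hui (by rw [h0]; rfl)⟩, hk,
        (le_abs_self _).trans_lt (hs k k.2).2, ⟨i, i.2, hui⟩, fun i hi j hj => ?_⟩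
      have h1 := hneg ⟨i, hi⟩
      have h2 := hneg ⟨j, hj⟩
      rw [hbu] at h1 h2
      exact mul_nonneg_of_nonpos_of_nonpos h1 h2)
  set n := Fintype.card ↥(P : Set V) with hn
  have := hP.nonempty
  have hn1 : (1 : ℝ) ≤ n := by exact_mod_cast Fintype.card_pos
  -- The factor `1 / n` absorbs the initial spread bound `n * R`.
  obtain ⟨r, hr⟩ := exists_pow_lt_of_lt_one (show (0 : ℝ) < 1 / n by positivity)
    (show 1 - 1 / (n : ℝ) ^ n < 1 by
      have : 0 < 1 / (n : ℝ) ^ n := by positivity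
      linarith)
  obtain ⟨κ, ⟨x₀, h⟩, hκ⟩ := not_bddAbove_iff.1 hsup (r * n + N)
  set T := r * n with hT
  have hspread : ∀ i j : ↥(P : Set V), state G R x₀ T i - state G R x₀ T j ≤ R := by
    intro i j
    refine (h.spread_le hR r (by rw [← hn, ← hT]; omega) i j).trans ?_
    rw [← hn, ← mul_assoc]
    refine mul_le_of_le_one_left hR.le ?_
    rw [lt_div_iff₀ (by positivity)] at hr
    exact hr.le
  have hlin := h.linear_regime hspread
  obtain ⟨xQ, hQ⟩ := h.consensus
  have hfar := fun {k : ℕ} (hk : k < κ) {i : ↥(P : Set V)} (hi : i ∈ boundary G P Q) =>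
    h.far_from_consensus hPQ hQ hk hi
  obtain ⟨c, e, he, hc⟩ := hexp fun i : ↥(P : Set V) => state G R x₀ T i
  set b : s → boundary G P Q → ℝ := fun k i => e k i with hbdef
  have hbB : b ∈ B := Submodule.mem_pi.2 fun k _ =>
    Submodule.mem_map.2 ⟨e k, Module.End.mem_eigenspace_iff.2 (he k), rfl⟩
  have hform : ∀ t, 1 ≤ t → T + t ≤ κ → ∀ i : boundary G P Q,
      state G R x₀ (T + t) i = c + ∑ k : s, (k : ℝ) ^ t * b k i := by
    intro t ht htκ i
    have h1 := (hlin t htκ).2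
    rw [hc t ht] at h1
    exact congrFun h1 i
  obtain ⟨-, -, i, hi, j, hj, hadj⟩ := h.merge
  set i₀ : boundary G P Q := ⟨⟨i, by simpa using hi⟩, j, hj, hadj.1⟩ with hi₀
  have hmerge : |state G R x₀ κ i₀ - xQ| ≤ R := by
    have := hadj.2
    rwa [hQ κ le_rfl j hj] at this
  obtain ⟨M, rfl⟩ : ∃ M, κ = T + M := ⟨κ - T, by omega⟩
  have hM : 1 ≤ M := by omega
  rw [hform M hM le_rfl, abs_le] at hmerge
  -- From `T` on, every opinion in `P` stays within `R` of that of `i₀` at `T`, which is farther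
  -- than `R` from `xQ`; this puts all boundary nodes on the side of `i₀`.
  rcases lt_abs.1 (hfar (k := T) (by omega) i₀.2) with hside | hside
  · have hlt := hN M (by omega) (-b) (B.neg_mem hbB) (c - xQ - R) (by
      intro t ht htM i
      have h1 := (abs_le.1 ((hlin t (by omega)).1 i i₀)).1
      have h2 := hfar (k := T + t) (by omega) i.2
      rcases lt_abs.1 h2 with h2 | h2
      · rw [hform t ht (by omega)] at h2
        simp only [Pi.neg_apply, mul_neg, Finset.sum_neg_distrib]
        linarith
      · linarith) i₀
    simp only [Pi.neg_apply, mul_neg, Finset.sum_neg_distrib] at hlt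
    linarith [hmerge.2]
  · have hlt := hN M (by omega) b hbB (xQ - R - c) (by
      intro t ht htM i
      have h1 := (abs_le.1 ((hlin t (by omega)).1 i i₀)).2
      have h2 := hfar (k := T + t) (by omega) i.2
      rcases lt_abs.1 h2 with h2 | h2
      · linarith
      · rw [hform t ht (by omega)] at h2
        linarith) i₀
    linarith [hmerge.1]
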